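/- Call a function $f:\mathbb{N}^*\to\mathbb{C}$ (where $\mathbb{N}^*=\{1,2,3,\dots\}$) a CMO function if it is not identically zero, satisfies $f(ab)=f(a)f(b)$ for all $a,b\in\mathbb{N}^*$, and $\sum_{n=1}^{\infty}f(n)=0$, in the sense that the partial sums $\sum_{n=1}^{N}f(n)$ converge to $0$ as $N\to+\infty$. Then the set $E$ of CMO functions is nonempty. For example, $n\mapsto\lambda(n)/n$ belongs to $E$, where $\lambda$ is the Liouville function, i.e. the completely multiplicative function with $\lambda(p)=-1$ for every prime $p$. -/

import Mathlib

/-- A function `f : ℕ+ → ℂ` is *CMO* if it is not identically zero, it is completely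
multiplicative, and the partial sums `f 1 + ⋯ + f N` converge to `0` as `N → ∞`. -/
structure IsCMO (f : ℕ+ → ℂ) : Prop where
  ne_zero : f ≠ 0
  map_mul : ∀ a b : ℕ+, f (a * b) = f a * f b
  tendsto_sum : Filter.Tendsto (fun N : ℕ => ∑ k ∈ Finset.range N, f k.succPNat)
    Filter.atTop (nhds 0)

/-- The set `E` of all CMO functions. -/
def setCMO : Set (ℕ+ → ℂ) := {f | IsCMO f}

/-!
The function `n ↦ λ n / n` is visibly completely multiplicative and nonzero, so everything rests
on `∑ λ n / n = 0` (`tendsto_sum_liouville_div`), a statement of the depth of the prime number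
theorem. It is deduced from the nonvanishing of `ζ` on the line `re s = 1` by a Tauberian theorem.

Put `u t = ∑ n ≤ exp t, λ n / n`. The function `u` is bounded because the divisor sums of `λ` are
bounded (`norm_sum_liouville_div_le_two`), and it oscillates slowly because `|λ n / n| ≤ 1 / n`
(`sum_liouville_div_exp_slowly_oscillating`). Its Laplace transform is `ζ(2 + 2z) / (z * ζ(1 + z))`
(`integral_sum_liouville_div_mul_exp`), which extends continuously to `0 ≤ re z`: the pole of `ζ`
at `1` cancels the factor `z`, and `ζ` has no zeros with `1 ≤ re s`.

The Tauberian theorem `tendsto_zero_of_laplace_continuousOn` then gives `u t → 0`. Its proof smooths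
`u` with the kernel `𝓕 φ`, where `φ` is smooth of compact support and `φ 0 = 1`. By Fubini and a
passage to the boundary, the smoothed function at `T` is the Fourier transform at `-T` of the
compactly supported function `ξ ↦ H (2πiξ) * φ ξ`, `H` being the Laplace transform
(`integral_mul_fourier_eq`), and so it tends to `0` by the Riemann–Lebesgue lemma. Since `u`
oscillates slowly, a sufficiently narrow rescaling of the kernel changes `u T` arbitrarily little.
-/

/-! ### Arithmetic of the Liouville function -/

lemma norm_intCast_liouville_le_one (n : ℕ) :
    ‖((ArithmeticFunction.liouville n : ℤ) : ℂ)‖ ≤ 1 := by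
  rcases eq_or_ne n 0 with rfl | hn
  · simp
  · simp [ArithmeticFunction.liouville_apply hn]

lemma liouville_mul_zeta_apply_prime_pow {p : ℕ} (hp : p.Prime) (k : ℕ) :
    (ArithmeticFunction.liouville * (ArithmeticFunction.zeta : ArithmeticFunction ℤ)) (p ^ k) =
      if Even (k + 1) then 0 else 1 := by
  rw [ArithmeticFunction.coe_mul_zeta_apply, Nat.sum_divisors_prime_pow hp, ← neg_one_geom_sum]
  refine Finset.sum_congr rfl fun i _ => ?_
  rw [ArithmeticFunction.liouville_apply (pow_ne_zero _ hp.ne_zero),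
    ArithmeticFunction.cardFactors_apply_prime_pow hp]

/-- The divisor sums `∑ d ∣ n, λ d` take only the values `0` and `1` (they detect squares); only
the bound is needed. -/
lemma abs_liouville_mul_zeta_le_one (n : ℕ) :
    |(ArithmeticFunction.liouville * (ArithmeticFunction.zeta : ArithmeticFunction ℤ)) n| ≤ 1 := by
  rcases eq_or_ne n 0 with rfl | hn
  · simp
  · have hm := ArithmeticFunction.isMultiplicative_liouville.mul
      (ArithmeticFunction.isMultiplicative_zeta.natCast (R := ℤ))
    rw [hm.multiplicative_factorization _ hn, Finsupp.prod, Finset.abs_prod]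
    refine Finset.prod_le_one (fun _ _ => abs_nonneg _) fun p hp => ?_
    rw [liouville_mul_zeta_apply_prime_pow (Nat.prime_of_mem_primeFactors hp)]
    split_ifs <;> simp

/-- Comparing `N / n` with `⌊N / n⌋` gives `N * ∑ n ≤ N, λ n / n = O(N) + ∑ n ≤ N, (λ * ζ) n`. -/
lemma norm_sum_liouville_div_le_two (N : ℕ) :
    ‖∑ n ∈ Finset.Icc 1 N, ((ArithmeticFunction.liouville n : ℤ) : ℂ) / n‖ ≤ 2 := by
  rcases Nat.eq_zero_or_pos N with rfl | hN
  · simp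
  have hN' : (0 : ℝ) < N := by exact_mod_cast hN
  have key : (N : ℂ) * ∑ n ∈ Finset.Icc 1 N, ((ArithmeticFunction.liouville n : ℤ) : ℂ) / n =
      ∑ n ∈ Finset.Icc 1 N, ((ArithmeticFunction.liouville n : ℤ) : ℂ) * ((N : ℂ) / n - (N / n : ℕ))
      + ∑ n ∈ Finset.Icc 1 N, (((ArithmeticFunction.liouville *
        (ArithmeticFunction.zeta : ArithmeticFunction ℤ)) n : ℤ) : ℂ) := by
    have h := ArithmeticFunction.sum_Ioc_mul_zeta_eq_sum ArithmeticFunction.liouville N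
    rw [show Finset.Ioc 0 N = Finset.Icc 1 N from rfl] at h
    rw [← Int.cast_sum, h, Finset.mul_sum]
    simp only [Int.cast_sum, Int.cast_mul, Int.cast_natCast]
    rw [← Finset.sum_add_distrib]
    refine Finset.sum_congr rfl fun n _ => ?_
    ring
  have h1 : ‖∑ n ∈ Finset.Icc 1 N, ((ArithmeticFunction.liouville n : ℤ) : ℂ) *
      ((N : ℂ) / n - (N / n : ℕ))‖ ≤ N := by
    refine (norm_sum_le_of_le (f := _) (n := fun _ => (1 : ℝ)) _ fun n hn => ?_).trans (by simp)
    rw [norm_mul]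
    refine mul_le_one₀ (norm_intCast_liouville_le_one n) (norm_nonneg _) ?_
    have e : ((N : ℂ) / n - (N / n : ℕ)) = (((N : ℝ) / n - (N / n : ℕ) : ℝ) : ℂ) := by
      push_cast
      rfl
    rw [e, Complex.norm_real, Real.norm_eq_abs, abs_le, ← Nat.floor_div_eq_div (K := ℝ)]
    have h0 : (0 : ℝ) ≤ (N : ℝ) / n := by positivity
    have := Nat.floor_le h0
    have := Nat.lt_floor_add_one ((N : ℝ) / n)
    constructor <;> linarith
  have h2 : ‖∑ n ∈ Finset.Icc 1 N, (((ArithmeticFunction.liouville *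
        (ArithmeticFunction.zeta : ArithmeticFunction ℤ)) n : ℤ) : ℂ)‖ ≤ N := by
    refine (norm_sum_le_of_le (f := _) (n := fun _ => (1 : ℝ)) _ fun n hn => ?_).trans (by simp)
    rw [Complex.norm_intCast]
    exact_mod_cast abs_liouville_mul_zeta_le_one n
  have h3 := congrArg norm key
  rw [norm_mul, Complex.norm_natCast] at h3
  have h4 := h3.trans_le (norm_add_le _ _)
  nlinarith

lemma intCast_liouville_prime {p : ℕ} (hp : p.Prime) :
    ((ArithmeticFunction.liouville p : ℤ) : ℂ) = -1 := by
  simp [ArithmeticFunction.liouville_apply hp.ne_zero,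
    ArithmeticFunction.cardFactors_apply_prime hp]

/-- The completely multiplicative function `n ↦ λ n * n ^ (-s)`, as a monoid homomorphism. -/
noncomputable def liouvilleSummandHom {s : ℂ} (hs : s ≠ 0) : ℕ →*₀ ℂ where
  toFun n := ((ArithmeticFunction.liouville n : ℤ) : ℂ) * riemannZetaSummandHom hs n
  map_zero' := by simp
  map_one' := by simp [ArithmeticFunction.liouville_apply_one]
  map_mul' m n := by
    rw [ArithmeticFunction.liouville_apply_mul, map_mul]
    push_cast
    ring

lemma summable_norm_liouvilleSummandHom {s : ℂ} (hs : 1 < s.re) :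
    Summable fun n => ‖liouvilleSummandHom (Complex.ne_zero_of_one_lt_re hs) n‖ := by
  refine (summable_riemannZetaSummand hs).of_nonneg_of_le (fun _ => norm_nonneg _) fun n => ?_
  change ‖((ArithmeticFunction.liouville n : ℤ) : ℂ) * _‖ ≤ _
  rw [norm_mul]
  exact mul_le_of_le_one_left (norm_nonneg _) (norm_intCast_liouville_le_one n)

/-- The Dirichlet series of `λ` is `ζ(2s) / ζ(s)`: compare Euler factors through
`1 - p ^ (-2s) = (1 - p ^ (-s)) * (1 + p ^ (-s))`. -/
lemma riemannZeta_mul_tsum_liouvilleSummandHom {s : ℂ} (hs : 1 < s.re) :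
    riemannZeta s * ∑' n, liouvilleSummandHom (Complex.ne_zero_of_one_lt_re hs) n =
      riemannZeta (2 * s) := by
  have hs2 : 1 < (2 * s).re := by simp; linarith
  have h := (riemannZeta_eulerProduct_hasProd hs).mul
    (EulerProduct.eulerProduct_completely_multiplicative_hasProd
      (summable_norm_liouvilleSummandHom hs))
  refine h.unique ?_
  convert! riemannZeta_eulerProduct_hasProd hs2 using 2 with p
  have e : liouvilleSummandHom (Complex.ne_zero_of_one_lt_re hs) p = -(p : ℂ) ^ (-s) := by
    change _ * (p : ℂ) ^ (-s) = _
    rw [intCast_liouville_prime p.2]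
    ring
  have e2 : (p : ℂ) ^ (-(2 * s)) = ((p : ℂ) ^ (-s)) ^ 2 := by
    rw [← Complex.cpow_nat_mul]
    congr 1
    push_cast
    ring
  rw [e, e2, ← mul_inv]
  congr 1
  ring

lemma term_liouville_div (z : ℂ) (hz' : 1 < (1 + z).re) (n : ℕ) :
    LSeries.term (fun n : ℕ => ((ArithmeticFunction.liouville n : ℤ) : ℂ) / n) z n =
      liouvilleSummandHom (Complex.ne_zero_of_one_lt_re hz') n := by
  rcases eq_or_ne n 0 with rfl | hn
  · simp
  have hn' : (n : ℂ) ≠ 0 := by exact_mod_cast hn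
  rw [LSeries.term_of_ne_zero hn]
  change _ = _ * (n : ℂ) ^ (-(1 + z))
  rw [Complex.cpow_neg, Complex.cpow_add _ _ hn', Complex.cpow_one, div_div, div_eq_mul_inv]

/-- The factor `z * ζ(1 + z)`, with its removable singularity at `0` filled in. -/
noncomputable def zetaShift : ℂ → ℂ :=
  Function.update (fun z => z * riemannZeta (1 + z)) 0 1

lemma continuous_zetaShift : Continuous zetaShift := by
  rw [continuous_iff_continuousAt]
  intro z
  rcases eq_or_ne z 0 with rfl | hz
  · rw [zetaShift, continuousAt_update_same]
    have h : Filter.Tendsto (fun z : ℂ => 1 + z) (nhdsWithin 0 {0}ᶜ) (nhdsWithin 1 {1}ᶜ) := by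
      refine tendsto_nhdsWithin_of_tendsto_nhds_of_eventually_within _ ?_ ?_
      · have : Continuous fun z : ℂ => 1 + z := by fun_prop
        simpa using (this.tendsto 0).mono_left nhdsWithin_le_nhds
      · filter_upwards [self_mem_nhdsWithin] with z hz
        simpa using hz
    simpa [Function.comp_def] using riemannZeta_residue_one.comp h
  · rw [zetaShift, continuousAt_update_of_ne hz]
    have h1 : ContinuousAt riemannZeta (1 + z) :=
      (differentiableAt_riemannZeta (by simpa using hz)).continuousAt
    have h2 : ContinuousAt (fun z : ℂ => 1 + z) z := by fun_prop
    exact continuousAt_id.mul (ContinuousAt.comp (f := fun z : ℂ => 1 + z) h1 h2)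

lemma zetaShift_ne_zero {z : ℂ} (hz : 0 ≤ z.re) : zetaShift z ≠ 0 := by
  rcases eq_or_ne z 0 with rfl | h
  · simp [zetaShift]
  · rw [zetaShift, Function.update_of_ne h]
    exact mul_ne_zero h (riemannZeta_ne_zero_of_one_le_re (by simpa using hz))

lemma continuousOn_zeta_div_zetaShift :
    ContinuousOn (fun z => riemannZeta (2 * (1 + z)) / zetaShift z) {z : ℂ | 0 ≤ z.re} := by
  refine ContinuousOn.div ?_ continuous_zetaShift.continuousOn fun z hz => zetaShift_ne_zero hz
  intro z hz
  have hz : 0 ≤ z.re := hz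
  have h1 : ContinuousAt riemannZeta (2 * (1 + z)) := by
    refine (differentiableAt_riemannZeta fun h => ?_).continuousAt
    have := congrArg Complex.re h
    simp at this
    linarith
  have h2 : ContinuousAt (fun z : ℂ => 2 * (1 + z)) z := by fun_prop
  exact (ContinuousAt.comp (f := fun z : ℂ => 2 * (1 + z)) h1 h2).continuousWithinAt

/-- The Laplace transform of `t ↦ ∑ n ≤ exp t, λ n / n` is `ζ(2 + 2z) / (z * ζ(1 + z))`. -/
lemma integral_sum_liouville_div_mul_exp {z : ℂ} (hz : 0 < z.re) :
    ∫ t in Set.Ioi (0 : ℝ), (∑ n ∈ Finset.Icc 1 ⌊Real.exp t⌋₊,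
      ((ArithmeticFunction.liouville n : ℤ) : ℂ) / n) * Complex.exp (-z * t) =
      riemannZeta (2 * (1 + z)) / zetaShift z := by
  have hz' : 1 < (1 + z).re := by simpa using hz
  have hz0 : z ≠ 0 := fun h => by simp [h] at hz
  have hterm := term_liouville_div z hz'
  have hsum : LSeriesSummable
      (fun n : ℕ => ((ArithmeticFunction.liouville n : ℤ) : ℂ) / n) z := by
    rw [LSeriesSummable, funext hterm]
    exact (summable_norm_liouvilleSummandHom hz').of_norm
  have hL := LSeries_eq_mul_integral _ le_rfl hz hsum (by
    simp only [Real.rpow_zero]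
    exact Asymptotics.isBigO_of_le' (c := 2) _ fun N => by
      simpa using norm_sum_liouville_div_le_two N)
  have hprod : riemannZeta (1 + z) * LSeries
      (fun n : ℕ => ((ArithmeticFunction.liouville n : ℤ) : ℂ) / n) z =
      riemannZeta (2 * (1 + z)) := by
    rw [LSeries, funext hterm]
    exact riemannZeta_mul_tsum_liouvilleSummandHom hz'
  have hsub := MeasureTheory.integral_comp_exp_Ioi (fun x : ℝ => (∑ n ∈ Finset.Icc 1 ⌊x⌋₊,
      ((ArithmeticFunction.liouville n : ℤ) : ℂ) / n) * (x : ℂ) ^ (-(z + 1))) 0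
  rw [Real.exp_zero] at hsub
  rw [eq_div_iff (zetaShift_ne_zero hz.le), zetaShift, Function.update_of_ne hz0, ← hprod, hL,
    ← hsub]
  have e : ∀ t : ℝ, (∑ n ∈ Finset.Icc 1 ⌊Real.exp t⌋₊,
      ((ArithmeticFunction.liouville n : ℤ) : ℂ) / n) * Complex.exp (-z * t) =
      Real.exp t • ((∑ n ∈ Finset.Icc 1 ⌊Real.exp t⌋₊,
      ((ArithmeticFunction.liouville n : ℤ) : ℂ) / n) * (Real.exp t : ℂ) ^ (-(z + 1))) := by
    intro t
    have h : Complex.exp (-z * t) = Real.exp t * (Real.exp t : ℂ) ^ (-(z + 1)) := by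
      rw [Complex.ofReal_exp, Complex.cpow_def_of_ne_zero (Complex.exp_ne_zero _),
        ← Complex.ofReal_exp, ← Complex.ofReal_log (Real.exp_pos t).le, Real.log_exp,
        Complex.ofReal_exp, ← Complex.exp_add]
      congr 1
      ring
    rw [h, Complex.real_smul]
    ring
  simp_rw [e]
  ring

/-! ### A Tauberian theorem for Laplace transforms -/

open FourierTransform in
lemma Real.fourier_exp_mul (φ : ℝ → ℂ) (T t : ℝ) :
    𝓕 (fun ξ : ℝ => Complex.exp (((2 * Real.pi * T * ξ : ℝ) : ℂ) * Complex.I) * φ ξ) t =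
      𝓕 φ (t - T) := by
  rw [Real.fourier_real_eq_integral_exp_smul, Real.fourier_real_eq_integral_exp_smul]
  refine MeasureTheory.integral_congr_ae (Filter.Eventually.of_forall fun ξ => ?_)
  simp only [smul_eq_mul]
  rw [← mul_assoc, ← Complex.exp_add]
  congr 2
  push_cast
  ring

open FourierTransform in
lemma Real.fourier_comp_div (φ : ℝ → ℂ) {R : ℝ} (hR : 0 < R) (t : ℝ) :
    𝓕 (fun ξ : ℝ => φ (ξ / R)) t = R • 𝓕 φ (R * t) := by
  rw [Real.fourier_real_eq_integral_exp_smul, Real.fourier_real_eq_integral_exp_smul]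
  have h := MeasureTheory.Measure.integral_comp_div
    (fun v : ℝ => Complex.exp (((-2 * Real.pi * v * (R * t) : ℝ) : ℂ) * Complex.I) • φ v) R
  rw [abs_of_pos hR] at h
  rw [← h]
  refine MeasureTheory.integral_congr_ae (Filter.Eventually.of_forall fun ξ => ?_)
  have e : -2 * Real.pi * (ξ / R) * (R * t) = -2 * Real.pi * ξ * t := by field_simp
  simp only [e]

open FourierTransform in
/-- Fubini for Fourier transforms on the real line. -/
lemma Real.integral_fourier_mul_eq {f g : ℝ → ℂ} (hf : MeasureTheory.Integrable f)
    (hg : MeasureTheory.Integrable g) : ∫ ξ, 𝓕 f ξ * g ξ = ∫ t, f t * 𝓕 g t := by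
  have h := VectorFourier.integral_fourierIntegral_smul_eq_flip (L := innerₗ ℝ)
    Real.continuous_fourierChar (by fun_prop : Continuous fun p : ℝ × ℝ => innerₗ ℝ p.1 p.2) hf hg
  rw [flip_innerₗ] at h
  exact h

lemma integrable_mul_of_norm_le {u K : ℝ → ℂ} {C : ℝ} (hu : Measurable u) (hC : ∀ t, ‖u t‖ ≤ C)
    (hK : MeasureTheory.Integrable K) : MeasureTheory.Integrable fun t => u t * K t :=
  hK.bdd_mul hu.aestronglyMeasurable (Filter.Eventually.of_forall hC)

open FourierTransform in
/-- Shifting the abscissa of the Laplace transform to `σ > 0` turns the smoothed value of `u` at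
`T` into an integral of the Laplace transform along a vertical line. -/
lemma integral_mul_exp_mul_fourier_eq {u : ℝ → ℂ} {C : ℝ} (hu : Measurable u)
    (hC : ∀ t, ‖u t‖ ≤ C) {H : ℂ → ℂ}
    (hH : ∀ z : ℂ, 0 < z.re → ∫ t in Set.Ioi (0 : ℝ), u t * Complex.exp (-z * t) = H z)
    {φ : ℝ → ℂ} (hφ : MeasureTheory.Integrable φ) (T : ℝ) {σ : ℝ} (hσ : 0 < σ) :
    ∫ ξ : ℝ, H (σ + (2 * Real.pi * ξ : ℝ) * Complex.I) *
        (Complex.exp (((2 * Real.pi * T * ξ : ℝ) : ℂ) * Complex.I) * φ ξ) =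
      ∫ t in Set.Ioi (0 : ℝ), Complex.exp (-(σ * t : ℝ)) * (u t * 𝓕 φ (t - T)) := by
  set f : ℝ → ℂ := (Set.Ioi (0 : ℝ)).indicator fun t => u t * Complex.exp (-(σ * t : ℝ)) with hf
  have hfi : MeasureTheory.Integrable f := by
    rw [hf, MeasureTheory.integrable_indicator_iff measurableSet_Ioi]
    refine MeasureTheory.Integrable.bdd_mul (c := C) ?_ hu.aestronglyMeasurable
      (Filter.Eventually.of_forall hC)
    have := (exp_neg_integrableOn_Ioi 0 hσ).ofReal (𝕜 := ℂ)
    simpa using! this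
  have hg : MeasureTheory.Integrable
      (fun ξ : ℝ => Complex.exp (((2 * Real.pi * T * ξ : ℝ) : ℂ) * Complex.I) * φ ξ) := by
    refine integrable_mul_of_norm_le (C := 1) (by fun_prop) (fun t => ?_) hφ
    rw [Complex.norm_exp_ofReal_mul_I]
  have h := Real.integral_fourier_mul_eq hfi hg
  have h1 : ∀ ξ : ℝ, 𝓕 f ξ = H (σ + (2 * Real.pi * ξ : ℝ) * Complex.I) := by
    intro ξ
    rw [← hH _ (by simpa using hσ), Real.fourier_real_eq_integral_exp_smul,
      ← MeasureTheory.integral_indicator measurableSet_Ioi]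
    refine MeasureTheory.integral_congr_ae (Filter.Eventually.of_forall fun t => ?_)
    by_cases ht : t ∈ Set.Ioi (0 : ℝ)
    · simp only [hf, Set.indicator_of_mem ht, smul_eq_mul]
      rw [mul_left_comm, ← Complex.exp_add]
      congr 2
      push_cast
      ring
    · simp [hf, Set.indicator_of_notMem ht]
  simp_rw [h1, Real.fourier_exp_mul] at h
  rw [h, ← MeasureTheory.integral_indicator measurableSet_Ioi]
  refine MeasureTheory.integral_congr_ae (Filter.Eventually.of_forall fun t => ?_)
  by_cases ht : t ∈ Set.Ioi (0 : ℝ)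
  · simp only [hf, Set.indicator_of_mem ht]
    ring
  · simp [hf, Set.indicator_of_notMem ht]

open FourierTransform in
/-- The previous identity in the limit `σ → 0`. -/
lemma integral_mul_fourier_eq {u : ℝ → ℂ} {C : ℝ} (hu : Measurable u)
    (hC : ∀ t, ‖u t‖ ≤ C) (hneg : ∀ t < 0, u t = 0) {H : ℂ → ℂ}
    (hH : ∀ z : ℂ, 0 < z.re → ∫ t in Set.Ioi (0 : ℝ), u t * Complex.exp (-z * t) = H z)
    (hHc : ContinuousOn H {z | 0 ≤ z.re}) {φ : ℝ → ℂ} (hφ : Continuous φ)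
    (hφs : HasCompactSupport φ) (hφi : MeasureTheory.Integrable (𝓕 φ)) (T : ℝ) :
    ∫ ξ : ℝ, H ((2 * Real.pi * ξ : ℝ) * Complex.I) *
        (Complex.exp (((2 * Real.pi * T * ξ : ℝ) : ℂ) * Complex.I) * φ ξ) =
      ∫ t, u t * 𝓕 φ (t - T) := by
  have hφ1 : MeasureTheory.Integrable φ := hφ.integrable_of_hasCompactSupport hφs
  have hline : Continuous fun p : ℝ × ℝ => (p.1 : ℂ) + (2 * Real.pi * p.2 : ℝ) * Complex.I := by
    fun_prop
  have hHl : ContinuousOn (fun p : ℝ × ℝ => H ((p.1 : ℂ) + (2 * Real.pi * p.2 : ℝ) * Complex.I))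
      {p | 0 ≤ p.1} :=
    hHc.comp hline.continuousOn fun p hp => by simpa using hp
  have hslice : ∀ σ : ℝ, 0 ≤ σ →
      Continuous fun ξ : ℝ => H ((σ : ℂ) + (2 * Real.pi * ξ : ℝ) * Complex.I) := fun σ hσ =>
    hHl.comp_continuous (f := fun ξ : ℝ => (σ, ξ)) (by fun_prop) fun _ => hσ
  obtain ⟨M, hM⟩ := ((isCompact_Icc (a := (0 : ℝ))
    (b := 1)).prod hφs.isCompact).exists_bound_of_continuousOn (hHl.mono fun p hp => hp.1.1)
  have hL : Filter.Tendsto (fun σ : ℝ => ∫ ξ : ℝ, H (σ + (2 * Real.pi * ξ : ℝ) * Complex.I) *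
        (Complex.exp (((2 * Real.pi * T * ξ : ℝ) : ℂ) * Complex.I) * φ ξ))
      (nhdsWithin 0 (Set.Ioi 0)) 
      (nhds (∫ ξ : ℝ, H (((0 : ℝ) : ℂ) + (2 * Real.pi * ξ : ℝ) * Complex.I) *
        (Complex.exp (((2 * Real.pi * T * ξ : ℝ) : ℂ) * Complex.I) * φ ξ))) := by
    refine MeasureTheory.tendsto_integral_filter_of_dominated_convergence (fun ξ => M * ‖φ ξ‖)
      ?_ ?_ (hφ1.norm.const_mul M) ?_
    · filter_upwards [self_mem_nhdsWithin] with σ hσ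
      have := hslice σ (le_of_lt hσ)
      exact (this.mul (by fun_prop)).aestronglyMeasurable
    · filter_upwards [Ioo_mem_nhdsGT (zero_lt_one (α := ℝ))] with σ hσ
      refine Filter.Eventually.of_forall fun ξ => ?_
      rw [norm_mul, norm_mul, Complex.norm_exp_ofReal_mul_I, one_mul]
      by_cases hξ : ξ ∈ tsupport φ
      · exact mul_le_mul_of_nonneg_right (hM (σ, ξ) ⟨⟨hσ.1.le, hσ.2.le⟩, hξ⟩) (norm_nonneg _)
      · simp [image_eq_zero_of_notMem_tsupport hξ]
    · refine Filter.Eventually.of_forall fun ξ => Filter.Tendsto.mul_const _ ?_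
      have h1 := hHl (0, ξ) (by simp)
      have h2 : Filter.Tendsto (fun σ : ℝ => (σ, ξ)) (nhdsWithin 0 (Set.Ioi 0))
          (nhdsWithin (0, ξ) {p : ℝ × ℝ | 0 ≤ p.1}) := by
        refine tendsto_nhdsWithin_of_tendsto_nhds_of_eventually_within _ ?_ ?_
        · have : Continuous fun σ : ℝ => (σ, ξ) := by fun_prop
          exact (this.tendsto 0).mono_left nhdsWithin_le_nhds
        · filter_upwards [self_mem_nhdsWithin] with σ hσ
          exact le_of_lt hσ
      exact h1.tendsto.comp h2
  have hR : Filter.Tendsto (fun σ : ℝ =>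
        ∫ t in Set.Ioi (0 : ℝ), Complex.exp (-(σ * t : ℝ)) * (u t * 𝓕 φ (t - T)))
      (nhdsWithin 0 (Set.Ioi 0)) (nhds (∫ t in Set.Ioi (0 : ℝ), u t * 𝓕 φ (t - T))) := by
    have hi : MeasureTheory.Integrable fun t => u t * 𝓕 φ (t - T) :=
      integrable_mul_of_norm_le hu hC (hφi.comp_sub_right T)
    refine MeasureTheory.tendsto_integral_filter_of_dominated_convergence
      (fun t => ‖u t * 𝓕 φ (t - T)‖) ?_ ?_ hi.norm.integrableOn ?_
    · refine Filter.Eventually.of_forall fun σ => ?_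
      refine MeasureTheory.AEStronglyMeasurable.mul ?_ hi.aestronglyMeasurable.restrict
      exact Continuous.aestronglyMeasurable (by fun_prop)
    · filter_upwards [self_mem_nhdsWithin] with σ hσ
      filter_upwards [MeasureTheory.ae_restrict_mem measurableSet_Ioi] with t ht
      rw [norm_mul]
      refine mul_le_of_le_one_left (norm_nonneg _) ?_
      rw [← Complex.ofReal_neg, Complex.norm_exp_ofReal, Real.exp_le_one_iff]
      exact neg_nonpos.2 (mul_nonneg (le_of_lt hσ) (le_of_lt ht))
    · refine Filter.Eventually.of_forall fun t => ?_
      have : Continuous fun σ : ℝ => Complex.exp (-(σ * t : ℝ)) * (u t * 𝓕 φ (t - T)) := by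
        fun_prop
      simpa using (this.tendsto 0).mono_left nhdsWithin_le_nhds
  have hEq := tendsto_nhds_unique (hL.congr' ?_) hR
  · rw [← MeasureTheory.integral_Ici_eq_integral_Ioi,
      MeasureTheory.setIntegral_eq_integral_of_forall_compl_eq_zero] at hEq
    · simpa using hEq
    · intro t ht
      rw [hneg t (by simpa using ht), zero_mul]
  · filter_upwards [self_mem_nhdsWithin] with σ hσ
    exact integral_mul_exp_mul_fourier_eq hu hC hH hφ1 T hσ

open FourierTransform in
/-- Smoothed values of `u` tend to `0`: on the transform side this is the Riemann–Lebesgue lemma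
on the boundary line. -/
lemma tendsto_integral_mul_fourier {u : ℝ → ℂ} {C : ℝ} (hu : Measurable u)
    (hC : ∀ t, ‖u t‖ ≤ C) (hneg : ∀ t < 0, u t = 0) {H : ℂ → ℂ}
    (hH : ∀ z : ℂ, 0 < z.re → ∫ t in Set.Ioi (0 : ℝ), u t * Complex.exp (-z * t) = H z)
    (hHc : ContinuousOn H {z | 0 ≤ z.re}) {φ : ℝ → ℂ} (hφ : Continuous φ)
    (hφs : HasCompactSupport φ) (hφi : MeasureTheory.Integrable (𝓕 φ)) :
    Filter.Tendsto (fun T => ∫ t, u t * 𝓕 φ (t - T)) Filter.atTop (nhds 0) := by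
  have h := (Real.zero_at_infty_fourier fun ξ : ℝ =>
    H ((2 * Real.pi * ξ : ℝ) * Complex.I) * φ ξ).comp
    (Filter.tendsto_neg_atTop_atBot.mono_right atBot_le_cocompact)
  refine h.congr fun T => ?_
  rw [← integral_mul_fourier_eq hu hC hneg hH hHc hφ hφs hφi, Function.comp_apply,
    Real.fourier_real_eq_integral_exp_smul]
  refine MeasureTheory.integral_congr_ae (Filter.Eventually.of_forall fun ξ => ?_)
  simp only [smul_eq_mul]
  rw [mul_left_comm]
  congr 4
  push_cast
  ring

open FourierTransform in
lemma tendsto_integral_comp_add_div_mul_fourier {u : ℝ → ℂ} {C : ℝ} (hu : Measurable u)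
    (hC : ∀ t, ‖u t‖ ≤ C) (hneg : ∀ t < 0, u t = 0) {H : ℂ → ℂ}
    (hH : ∀ z : ℂ, 0 < z.re → ∫ t in Set.Ioi (0 : ℝ), u t * Complex.exp (-z * t) = H z)
    (hHc : ContinuousOn H {z | 0 ≤ z.re}) {φ : ℝ → ℂ} (hφ : Continuous φ)
    (hφs : HasCompactSupport φ) (hφi : MeasureTheory.Integrable (𝓕 φ)) {R : ℝ} (hR : 0 < R) :
    Filter.Tendsto (fun T => ∫ s, u (T + s / R) * 𝓕 φ s) Filter.atTop (nhds 0) := by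
  have hF : 𝓕 (fun ξ : ℝ => φ (ξ / R)) = fun t => R • 𝓕 φ (R * t) :=
    funext (Real.fourier_comp_div φ hR)
  have hs : HasCompactSupport fun ξ : ℝ => φ (ξ / R) := by
    simpa [div_eq_inv_mul] using! hφs.comp_smul (c := R⁻¹) (by positivity)
  have h := tendsto_integral_mul_fourier hu hC hneg hH hHc (φ := fun ξ => φ (ξ / R))
    (by fun_prop) hs (by rw [hF]; exact (hφi.comp_mul_left' hR.ne').smul R)
  refine h.congr fun T => ?_
  rw [hF]
  -- substitute `t = T + s / R`
  have h1 := MeasureTheory.integral_add_left_eq_self (μ := MeasureTheory.volume)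
    (fun t => u t * R • 𝓕 φ (R * (t - T))) T
  have h2 := MeasureTheory.Measure.integral_comp_div
    (fun s => u (T + s) * 𝓕 φ (R * s)) R
  rw [abs_of_pos hR] at h2
  rw [← h1]
  simp only [add_sub_cancel_left, mul_smul_comm, MeasureTheory.integral_smul]
  rw [← h2]
  refine MeasureTheory.integral_congr_ae (Filter.Eventually.of_forall fun s => ?_)
  simp only
  rw [mul_div_cancel₀ _ hR.ne']

open FourierTransform in
/-- A smooth compactly supported function with value `1` at `0` has a Fourier transform that is an
approximate identity after rescaling. -/
lemma exists_fourier_kernel : ∃ φ : ℝ → ℂ, Continuous φ ∧ HasCompactSupport φ ∧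
    MeasureTheory.Integrable (𝓕 φ) ∧ MeasureTheory.Integrable (fun t => |t| * ‖𝓕 φ t‖) ∧
    ∫ t, 𝓕 φ t = 1 := by
  let b : ContDiffBump (0 : ℝ) := ⟨1, 2, by norm_num, by norm_num⟩
  have hb : ContDiff ℝ (⊤ : ℕ∞) fun x => (b x : ℂ) :=
    Complex.ofRealCLM.contDiff.comp b.contDiff
  have hs : HasCompactSupport fun x => (b x : ℂ) :=
    b.hasCompactSupport.comp_left Complex.ofReal_zero
  let f := hs.toSchwartzMap hb
  have hi : MeasureTheory.Integrable (𝓕 fun x => (b x : ℂ)) := (𝓕 f).integrable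
  refine ⟨fun x => (b x : ℂ), hb.continuous, hs, hi, ?_, ?_⟩
  · have h := (𝓕 f).integrable_pow_mul MeasureTheory.volume 1
    simp only [pow_one, Real.norm_eq_abs] at h
    exact h
  · have h := congrFun (hb.continuous.fourierInv_fourier_eq
      (hb.continuous.integrable_of_hasCompactSupport hs) hi) 0
    rw [Real.fourierInv_eq] at h
    have hb0 : b 0 = 1 := b.one_of_mem_closedBall (by simp [b])
    simpa [hb0] using h

/-- A bounded, slowly oscillating function on the half line whose Laplace transform extends
continuously to the closed half plane `0 ≤ re z` tends to `0`. -/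
theorem tendsto_zero_of_laplace_continuousOn {u : ℝ → ℂ} {C : ℝ} (hu : Measurable u)
    (hC : ∀ t, ‖u t‖ ≤ C) (hneg : ∀ t < 0, u t = 0)
    (hosc : ∀ ε > 0, ∃ δ > 0, ∀ᶠ T in Filter.atTop, ∀ s, |s| ≤ δ → ‖u T - u (T + s)‖ ≤ ε)
    {H : ℂ → ℂ}
    (hH : ∀ z : ℂ, 0 < z.re → ∫ t in Set.Ioi (0 : ℝ), u t * Complex.exp (-z * t) = H z)
    (hHc : ContinuousOn H {z | 0 ≤ z.re}) :
    Filter.Tendsto u Filter.atTop (nhds 0) := by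
  obtain ⟨φ, hφ, hφs, hφi, hφ1, hφI⟩ := exists_fourier_kernel
  set K := FourierTransform.fourier φ with hK
  set A := ∫ t, ‖K t‖ with hA
  set B := ∫ t, |t| * ‖K t‖ with hB
  have hA0 : 0 ≤ A := MeasureTheory.integral_nonneg fun _ => norm_nonneg _
  have hB0 : 0 ≤ B := MeasureTheory.integral_nonneg fun _ => by positivity
  have hC0 : 0 ≤ C := (norm_nonneg _).trans (hC 0)
  rw [NormedAddGroup.tendsto_nhds_zero]
  intro ε hε
  set η := ε / (3 * (A + 1)) with hη
  obtain ⟨δ, hδ, hosc⟩ := hosc η (by positivity)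
  -- the rescaling `R` makes the mass of the kernel outside a `δ`-neighbourhood negligible
  set R := 3 * (2 * C / δ * B + 1) / ε with hRd
  have hR : 0 < R := by positivity
  have hlim := tendsto_integral_comp_add_div_mul_fourier hu hC hneg hH hHc hφ hφs hφi hR
  rw [NormedAddGroup.tendsto_nhds_zero] at hlim
  filter_upwards [hlim (ε / 3) (by positivity), hosc] with T hT hoT
  have hpt : ∀ s, ‖u T - u (T + s / R)‖ ≤ η + 2 * C / (δ * R) * |s| := by
    intro s
    rcases le_or_gt |s / R| δ with h | h
    · exact (hoT _ h).trans (le_add_of_nonneg_right (by positivity))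
    · have h1 : ‖u T - u (T + s / R)‖ ≤ 2 * C :=
        (norm_sub_le _ _).trans (by linarith [hC T, hC (T + s / R)])
      rw [abs_div, abs_of_pos hR, lt_div_iff₀ hR] at h
      have h2 : 2 * C ≤ 2 * C / (δ * R) * |s| := by
        rw [div_mul_eq_mul_div, le_div_iff₀ (by positivity)]
        exact mul_le_mul_of_nonneg_left h.le (by positivity)
      have : 0 < η := by positivity
      linarith
  have hi1 : MeasureTheory.Integrable fun s => u T * K s := hφi.const_mul _
  have hi2 : MeasureTheory.Integrable fun s => u (T + s / R) * K s :=
    integrable_mul_of_norm_le (hu.comp (by fun_prop)) (fun _ => hC _) hφi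
  have hdiff : ‖u T - ∫ s, u (T + s / R) * K s‖ ≤ η * A + 2 * C / (δ * R) * B := by
    have e : u T - ∫ s, u (T + s / R) * K s = ∫ s, (u T - u (T + s / R)) * K s := by
      simp_rw [sub_mul]
      rw [MeasureTheory.integral_sub hi1 hi2, MeasureTheory.integral_const_mul, hφI, mul_one]
    rw [e, hA, hB, ← MeasureTheory.integral_const_mul, ← MeasureTheory.integral_const_mul,
      ← MeasureTheory.integral_add (hφi.norm.const_mul _) (hφ1.const_mul _)]
    refine MeasureTheory.norm_integral_le_of_norm_le
      ((hφi.norm.const_mul _).add (hφ1.const_mul _)) (Filter.Eventually.of_forall fun s => ?_)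
    rw [norm_mul]
    refine (mul_le_mul_of_nonneg_right (hpt s) (norm_nonneg _)).trans_eq ?_
    ring
  have hb1 : η * A < ε / 3 := by
    rw [hη, div_mul_eq_mul_div, div_lt_div_iff₀ (by positivity) (by positivity)]
    nlinarith
  have hb2 : 2 * C / (δ * R) * B < ε / 3 := by
    have e : 2 * C / (δ * R) * B = (2 * C / δ * B) / R := by field_simp
    rw [e, div_lt_iff₀ hR, hRd]
    have : ε / 3 * (3 * (2 * C / δ * B + 1) / ε) = 2 * C / δ * B + 1 := by field_simp
    linarith
  calc ‖u T‖ = ‖(u T - ∫ s, u (T + s / R) * K s) + ∫ s, u (T + s / R) * K s‖ := by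
        rw [sub_add_cancel]
    _ ≤ _ := norm_add_le _ _
    _ < ε := by linarith

/-! ### Convergence of `∑ λ n / n` to zero -/

/-- The number of integers in `(exp a, exp b]` is at most `exp b - exp a + 1`, and each term of the
sum over them is at most `exp (-a)`. -/
lemma norm_sum_liouville_div_exp_sub_le {a b : ℝ} (hab : a ≤ b) :
    ‖∑ n ∈ Finset.Icc 1 ⌊Real.exp b⌋₊, ((ArithmeticFunction.liouville n : ℤ) : ℂ) / n -
      ∑ n ∈ Finset.Icc 1 ⌊Real.exp a⌋₊, ((ArithmeticFunction.liouville n : ℤ) : ℂ) / n‖ ≤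
      Real.exp (b - a) - 1 + Real.exp (-a) := by
  have hfl : ⌊Real.exp a⌋₊ ≤ ⌊Real.exp b⌋₊ := Nat.floor_le_floor (Real.exp_le_exp.2 hab)
  have hsplit : ∑ n ∈ Finset.Icc 1 ⌊Real.exp b⌋₊, ((ArithmeticFunction.liouville n : ℤ) : ℂ) / n -
      ∑ n ∈ Finset.Icc 1 ⌊Real.exp a⌋₊, ((ArithmeticFunction.liouville n : ℤ) : ℂ) / n =
      ∑ n ∈ Finset.Ioc ⌊Real.exp a⌋₊ ⌊Real.exp b⌋₊,
        ((ArithmeticFunction.liouville n : ℤ) : ℂ) / n := by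
    rw [sub_eq_iff_eq_add', show Finset.Icc 1 ⌊Real.exp b⌋₊ = Finset.Ioc 0 ⌊Real.exp b⌋₊ from rfl,
      show Finset.Icc 1 ⌊Real.exp a⌋₊ = Finset.Ioc 0 ⌊Real.exp a⌋₊ from rfl]
    exact (Finset.sum_Ioc_consecutive _ (Nat.zero_le _) hfl).symm
  rw [hsplit]
  refine (norm_sum_le_of_le (n := fun _ => Real.exp (-a)) _ fun n hn => ?_).trans ?_
  · have h1 : Real.exp a < n := (Nat.floor_lt (Real.exp_pos a).le).1 (Finset.mem_Ioc.1 hn).1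
    rw [norm_div, Complex.norm_natCast, Real.exp_neg, ← one_div]
    exact div_le_div₀ zero_le_one (norm_intCast_liouville_le_one n) (Real.exp_pos a) h1.le
  · rw [Finset.sum_const, Nat.card_Ioc, nsmul_eq_mul, Nat.cast_sub hfl]
    have h1 := Nat.floor_le (Real.exp_pos b).le
    have h2 := Nat.lt_floor_add_one (Real.exp a)
    have h3 : Real.exp (b - a) - 1 + Real.exp (-a) =
        (Real.exp b - Real.exp a + 1) * Real.exp (-a) := by
      rw [add_mul, sub_mul, ← Real.exp_add, ← Real.exp_add, one_mul]
      simp [sub_eq_add_neg]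
    rw [h3]
    exact mul_le_mul_of_nonneg_right (by linarith) (Real.exp_pos _).le

lemma sum_liouville_div_exp_slowly_oscillating {ε : ℝ} (hε : 0 < ε) :
    ∃ δ > 0, ∀ᶠ T : ℝ in Filter.atTop, ∀ s : ℝ, |s| ≤ δ →
      ‖∑ n ∈ Finset.Icc 1 ⌊Real.exp T⌋₊, ((ArithmeticFunction.liouville n : ℤ) : ℂ) / n -
        ∑ n ∈ Finset.Icc 1 ⌊Real.exp (T + s)⌋₊,
          ((ArithmeticFunction.liouville n : ℤ) : ℂ) / n‖ ≤ ε := by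
  refine ⟨Real.log (1 + ε / 2), Real.log_pos (by linarith), ?_⟩
  set δ := Real.log (1 + ε / 2) with hδ
  have hexp : Real.exp δ = 1 + ε / 2 := Real.exp_log (by positivity)
  have hlim : Filter.Tendsto (fun T : ℝ => Real.exp (-(T - δ))) Filter.atTop (nhds 0) :=
    Real.tendsto_exp_neg_atTop_nhds_zero.comp (Filter.tendsto_atTop_add_const_right _ (-δ)
      Filter.tendsto_id)
  filter_upwards [hlim.eventually_le_const (half_pos hε)] with T hT s hs
  obtain ⟨hs1, hs2⟩ := abs_le.1 hs
  have key : ∀ r x : ℝ, r ≤ δ → -x ≤ -(T - δ) →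
      Real.exp r - 1 + Real.exp (-x) ≤ ε := fun r x hr hx => by
    have := Real.exp_le_exp.2 hr
    have := Real.exp_le_exp.2 hx
    linarith
  rcases le_total s 0 with h | h
  · exact (norm_sum_liouville_div_exp_sub_le (by linarith)).trans
      (key _ _ (by linarith) (by linarith))
  · rw [norm_sub_rev]
    exact (norm_sum_liouville_div_exp_sub_le (by linarith)).trans
      (key _ _ (by linarith) (by linarith))

theorem tendsto_sum_liouville_div :
    Filter.Tendsto (fun N : ℕ => ∑ n ∈ Finset.Icc 1 N,
      ((ArithmeticFunction.liouville n : ℤ) : ℂ) / n) Filter.atTop (nhds 0) := by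
  have hmeas : Measurable fun t : ℝ => ∑ n ∈ Finset.Icc 1 ⌊Real.exp t⌋₊,
      ((ArithmeticFunction.liouville n : ℤ) : ℂ) / n :=
    (measurable_from_nat (f := fun N : ℕ => ∑ n ∈ Finset.Icc 1 N,
      ((ArithmeticFunction.liouville n : ℤ) : ℂ) / n)).comp
      (Nat.measurable_floor.comp Real.measurable_exp)
  have h := tendsto_zero_of_laplace_continuousOn hmeas
    (fun t => norm_sum_liouville_div_le_two _) (fun t ht => by simp [Nat.floor_eq_zero.2, ht])
    (fun ε hε => sum_liouville_div_exp_slowly_oscillating hε)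
    (fun z hz => integral_sum_liouville_div_mul_exp hz) continuousOn_zeta_div_zetaShift
  refine (h.comp (Real.tendsto_log_atTop.comp tendsto_natCast_atTop_atTop)).congr' ?_
  filter_upwards [Filter.eventually_gt_atTop 0] with N hN
  have hN' : (0 : ℝ) < N := by exact_mod_cast hN
  simp [Real.exp_log hN']

lemma isCMO_liouville_div :
    IsCMO fun n : ℕ+ => ((ArithmeticFunction.liouville (n : ℕ) : ℤ) : ℂ) / ((n : ℕ) : ℂ) where
  ne_zero h := by simpa [ArithmeticFunction.liouville_apply_one] using congrFun h 1
  map_mul a b := by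
    rw [PNat.mul_coe, ArithmeticFunction.liouville_apply_mul]
    push_cast
    rw [mul_div_mul_comm]
  tendsto_sum := by
    refine tendsto_sum_liouville_div.congr fun N => ?_
    induction N with
    | zero => simp
    | succ N ih =>
      rw [Finset.sum_Icc_succ_top (by lia), ih, Finset.sum_range_succ, Nat.succPNat_coe,
        Nat.succ_eq_add_one]

theorem mainTheorem11 :
    setCMO.Nonempty ∧
      (fun n : ℕ+ => ((ArithmeticFunction.liouville (n : ℕ) : ℤ) : ℂ) / ((n : ℕ) : ℂ)) ∈ setCMO :=
  ⟨⟨_, isCMO_liouville_div⟩, isCMO_liouville_div⟩
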